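/- Rings are unital, modules are left modules, and for a prime $\mathfrak p$ of a commutative ring $R$ the subscript $\mathfrak p$ denotes localization at $R\setminus\mathfrak p$. Let $R$ be a reduced commutative ring which is pseudo-noetherian: for every $a\in R$ the set of primes minimal among those containing $a$ is finite, and $R_{\mathfrak p}$ is noetherian for every such prime $\mathfrak p$. Let $Q$ be the total ring of fractions of $R$; if $\mathfrak n_1,\dots,\mathfrak n_s$ are the minimal primes of $R$, then $Q=\prod_{j=1}^s Q_j$ with fields $Q_j=R_{\mathfrak n_j}$. Let $A$ be a (not necessarily commutative) $R$-algebra which is a reduced pseudo-noetherian order: $A_{\mathfrak p}$ is left and right noetherian for every prime $\mathfrak p$ of $R$ of height at most $1$, $QA=Q\otimes_R A$ is finite over $Q$, $A$ has no nonzero nilpotent two-sided ideals, and $A$ is torsion free over $R$ (no non-zero-divisor of $R$ kills a nonzero element of $A$). (Then $QA=\prod_j Q_jA$ is semisimple, where $Q_jA=A_{\mathfrak n_j}$.) An $A$-module $M$ is called codivisorial if its only submodule $X$ with $X_{\mathfrak p}=0$ for all primes $\mathfrak p$ of $R$ of height $1$ is $X=0$. Theorem. Let $E$ be an indecomposable injective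 codivisorial $A$-module. Then at least one of the following holds: (1) for some $j$, $E$ is isomorphic as an $A$-module to a simple left ideal of the ring $Q_jA$ (that is, to a simple component of the semisimple module $QA$; for $A=R$ this means $E\simeq Q_j$); (2) there are a prime $\mathfrak p$ of $R$ of height $1$ and a prime two-sided ideal $\mathfrak P$ of $A$ whose preimage in $R$ is $\mathfrak p$, such that $E\simeq E(U_{\mathfrak P})$, the injective envelope over $A$ of $U_{\mathfrak P}$, where $U_{\mathfrak P}$ is the simple $A_{\mathfrak p}$-module with $\operatorname{ann}_A U_{\mathfrak P}=\mathfrak P$, regarded as an $A$-module. -/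

import Mathlib

universe u v w

namespace PseudoKrull

/-- A commutative ring `R` is pseudo-noetherian if for every `a : R` there are only finitely many
primes minimal among those containing `a`, and the localization of `R` at each of them is
noetherian. -/
structure IsPseudoNoetherianRing (R : Type u) [CommRing R] : Prop where
  finite_minimalPrimes : ∀ a : R, (Ideal.span {a}).minimalPrimes.Finite
  noetherian_atPrime : ∀ (a : R) (p : PrimeSpectrum R),
    p.asIdeal ∈ (Ideal.span {a}).minimalPrimes →
      IsNoetherianRing (Localization.AtPrime p.asIdeal)

/-- The localization `A_p` of an `R`-algebra `A` at a prime `p` of `R`, as a ring. -/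
abbrev LocAlg {R : Type u} [CommRing R] (A : Type v) [Ring A] [Algebra R A]
    (p : PrimeSpectrum R) : Type (max u v) :=
  LocalizedModule p.asIdeal.primeCompl A

/-- The image `a / 1` in `A_p` of an element `a` of `A`. -/
def toLoc {R : Type u} [CommRing R] {A : Type v} [Ring A] [Algebra R A]
    (p : PrimeSpectrum R) (a : A) : LocAlg A p :=
  LocalizedModule.mk a 1

/-- A (not necessarily commutative) ring is reduced if it has no nonzero nilpotent two-sided
ideals. -/
def HasNoNilpotentIdeals (A : Type v) [Ring A] : Prop :=
  ∀ I : Ideal A, I.IsTwoSided → IsNilpotent I → I = ⊥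

/-- `A` is a reduced pseudo-noetherian order over the commutative ring `R`. -/
structure IsReducedPseudoNoetherianOrder (R : Type u) [CommRing R] (A : Type v) [Ring A]
    [Algebra R A] : Prop where
  noetherian_left : ∀ p : PrimeSpectrum R, p.asIdeal.height ≤ 1 → IsNoetherianRing (LocAlg A p)
  noetherian_right : ∀ p : PrimeSpectrum R, p.asIdeal.height ≤ 1 →
    IsNoetherianRing (LocAlg A p)ᵐᵒᵖ
  /-- `QA` is a finite algebra over the total ring of fractions `Q` of `R`. -/
  finite_total : Module.Finite (Localization (nonZeroDivisors R))
    (LocalizedModule (nonZeroDivisors R) A)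
  reduced : HasNoNilpotentIdeals A
  torsionFree : Module.IsTorsionFree R A

/-- An `A`-module `M` is codivisorial if its only `A`-submodule `X` such that `X_p = 0` for all
primes `p` of `R` of height one is `X = 0`. -/
def IsCodivisorial (R : Type u) [CommRing R] (A : Type v) [Ring A] [Algebra R A]
    (M : Type w) [AddCommGroup M] [Module R M] [Module A M] [IsScalarTower R A M] : Prop :=
  ∀ X : Submodule A M,
    (∀ p : PrimeSpectrum R, p.asIdeal.height = 1 →
      Subsingleton (LocalizedModule p.asIdeal.primeCompl X)) → X = ⊥

/-- A module is indecomposable if it is nonzero and is not the direct sum of two nonzero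
submodules. -/
def IsIndecomposable (A : Type v) [Ring A] (M : Type w) [AddCommGroup M] [Module A M] : Prop :=
  Nontrivial M ∧ ∀ N N' : Submodule A M, IsCompl N N' → N = ⊥ ∨ N' = ⊥

/-- `i : U → E` exhibits `E` as an injective envelope of `U`: `E` is injective and `i` is an
essential embedding. -/
structure IsInjectiveEnvelope {A : Type v} [Ring A] {U E : Type w} [AddCommGroup U] [Module A U]
    [AddCommGroup E] [Module A E] (i : U →ₗ[A] E) : Prop where
  injective_module : Module.Injective A E
  injective_map : Function.Injective i
  essential : ∀ N : Submodule A E, N ⊓ LinearMap.range i = ⊥ → N = ⊥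

/-- Prime two-sided ideals of a not necessarily commutative ring: proper two-sided ideals `P`
such that `I * J ≤ P` implies `I ≤ P` or `J ≤ P` for two-sided ideals `I`, `J`. -/
structure IsPrimeIdeal {A : Type v} [Ring A] (P : Ideal A) : Prop where
  isTwoSided : P.IsTwoSided
  ne_top : P ≠ ⊤
  le_or_le : ∀ I J : Ideal A, I.IsTwoSided → J.IsTwoSided → I * J ≤ P → I ≤ P ∨ J ≤ P

/-- The prime `P` of `A` lies over the prime `p` of `R`: `P ∩ R = p`. -/
def LiesOverPrime {R : Type u} [CommRing R] {A : Type v} [Ring A] [Algebra R A]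
    (P : Ideal A) (p : PrimeSpectrum R) : Prop :=
  IsPrimeIdeal P ∧ P.comap (algebraMap R A) = p.asIdeal

/-- For a prime `P` of `A` over `p`: the `A_p`-module `U`, regarded also as an `A`-module via
`A → A_p`, is the simple `A_p`-module `U_P`, which is characterized by having `P` as its
annihilator in `A`. -/
structure IsSimpleAttachedTo {R : Type u} [CommRing R] {A : Type v} [Ring A] [Algebra R A]
    (P : Ideal A) (p : PrimeSpectrum R) (U : Type w) [AddCommGroup U] [Module A U]
    [Module (LocAlg A p) U] : Prop where
  restrict : ∀ (a : A) (x : U), toLoc p a • x = a • x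
  simple : IsSimpleModule (LocAlg A p) U
  annihilator_eq : Module.annihilator A U = P

/-- The `A`-module `E` is isomorphic, as an `A`-module, to some simple left ideal of `A_n`. For a
minimal prime `n` of a reduced pseudo-noetherian ring, `A_n` is the component `Q_j A` of the
semisimple ring `Q A` that belongs to the component `Q_j = R_n` of `Q`. -/
def IsSimpleComponentAt {R : Type u} [CommRing R] {A : Type v} [Ring A] [Algebra R A]
    (n : PrimeSpectrum R) (E : Type w) [AddCommGroup E] [Module A E] : Prop :=
  ∃ I : Ideal (LocAlg A n), IsSimpleModule (LocAlg A n) I ∧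
    ∃ e : E ≃+ I, ∀ (a : A) (x : E), e (a • x) = toLoc n a • e x

end PseudoKrull

/-!
Let `q` be the set of elements of `R` that act non-injectively on `E`. An indecomposable injective
module is uniform, and its injective endomorphisms are bijective (`IsIndecomposable.eq_bot_or_eq_bot`,
`IsIndecomposable.bijective_of_injective`). Hence `q` is a prime ideal and `E` is a module over
`A_q`.

If `q` consists of zero divisors, it is a minimal prime by prime avoidance. Then `A_q` is finite over
the artinian ring `R_q` and semiprime, hence semisimple, and `E`, being indecomposable, is a simple
`A_q`-module (`isSimpleComponentAt`).

Otherwise `q` contains a regular element `a`. Only finitely many primes of height one contain `a`,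
and at every other prime of height one the submodule generated by an element killed by `a` vanishes.
Codivisoriality and uniformity then produce a prime of height one at which `E` has no torsion, and
this prime is `q` (`height_nonInjectivePrime`). The ring `A_q` need not be finite over `R_q`, but it
is torsion free of finite rank over a one-dimensional noetherian ring, so the length bound in the
Krull-Akizuki theorem shows that `A_q / a A_q` has finite length over `R_q`
(`isFiniteLength_quotient_smul`). Therefore `E` contains a simple `A_q`-module `U`, and by uniformity
`E` is an injective envelope of `U` (`exists_isInjectiveEnvelope`). Every element of `q` has a
nonzero kernel on `E`, which meets `U`, so the annihilator of `U` lies over `q`.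
-/

namespace PseudoKrull

/-! ### Indecomposable injective modules are uniform -/

section Uniform

variable {A : Type v} [Ring A] {E : Type w} [AddCommGroup E] [Module A E]

/-- Zorn's lemma applies because submodules disjoint from `X` are closed under directed
suprema. -/
theorem exists_maximal_disjoint {X Y : Submodule A E} (h : Disjoint Y X) :
    ∃ C, Y ≤ C ∧ Maximal (fun C : Submodule A E ↦ Disjoint C X) C := by
  refine zorn_le_nonempty₀ {C : Submodule A E | Disjoint C X} (fun c hc hchain y hy ↦ ?_) Y h
  exact ⟨sSup c, (hchain.directedOn.disjoint_sSup_left).2 fun b hb ↦ hc hb,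
    fun z hz ↦ le_sSup hz⟩

/-- If `C` and `D` are maximal among the submodules disjoint from each other, then they are
complementary. The inclusion of `D` extends along the essential embedding `D → E ⧸ C` to an
embedding `E ⧸ C → E`, whose range contains `D` and is disjoint from `C`, hence equals `D`. -/
theorem isCompl_of_maximal_disjoint (hinj : Module.Injective A E) {C D : Submodule A E}
    (hC : Maximal (fun C : Submodule A E ↦ Disjoint C D) C)
    (hD : Maximal (fun D : Submodule A E ↦ Disjoint D C) D) : IsCompl C D := by
  have hdisj : Disjoint C D := hC.prop
  obtain ⟨g, hg⟩ := hinj.out (C.mkQ ∘ₗ D.subtype) (by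
    rw [injective_iff_map_eq_zero]
    rintro ⟨x, hxD⟩ hx
    have hxC : x ∈ C := (Submodule.Quotient.mk_eq_zero C).1 hx
    exact Subtype.ext (Submodule.disjoint_def.1 hdisj x hxC hxD)) D.subtype
  have hgD : ∀ x ∈ D, g (C.mkQ x) = x := fun x hx ↦ hg ⟨x, hx⟩
  have hgC : ∀ x ∈ C, g (C.mkQ x) = 0 := fun x hx ↦ by
    rw [C.mkQ_apply, (Submodule.Quotient.mk_eq_zero C).2 hx, map_zero]
  -- the preimage of `C` under `E → E ⧸ C → E` contains `C` and is disjoint from `D`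
  have hpre : ∀ x, g (C.mkQ x) ∈ C → x ∈ C := by
    have h1 : Disjoint (C.comap (g ∘ₗ C.mkQ)) D := by
      rw [Submodule.disjoint_def]
      intro y hy hyD
      have hy' : g (C.mkQ y) ∈ C := hy
      rw [hgD y hyD] at hy'
      exact Submodule.disjoint_def.1 hdisj y hy' hyD
    have h2 : C ≤ C.comap (g ∘ₗ C.mkQ) := fun y hy ↦ by
      rw [Submodule.mem_comap, LinearMap.comp_apply, hgC y hy]
      exact C.zero_mem
    exact fun x hx ↦ hC.le_of_ge h1 h2 hx
  have hrange : ∀ x, g (C.mkQ x) ∈ D := by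
    have h1 : Disjoint (LinearMap.range (g ∘ₗ C.mkQ)) C := by
      rw [Submodule.disjoint_def]
      rintro _ ⟨x, rfl⟩ hx
      exact hgC x (hpre x hx)
    have h2 : D ≤ LinearMap.range (g ∘ₗ C.mkQ) := fun y hy ↦ ⟨y, hgD y hy⟩
    exact fun x ↦ hD.le_of_ge h1 h2 ⟨x, rfl⟩
  refine ⟨hdisj, codisjoint_iff.2 (eq_top_iff.2 fun x _ ↦ ?_)⟩
  have hxC : x - g (C.mkQ x) ∈ C :=
    hpre _ (by rw [map_sub, map_sub, hgD _ (hrange x), sub_self]; exact C.zero_mem)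
  rw [← sub_add_cancel x (g (C.mkQ x))]
  exact Submodule.add_mem_sup hxC (hrange x)

/-- An indecomposable injective module is uniform. -/
theorem IsIndecomposable.eq_bot_or_eq_bot (hind : IsIndecomposable A E)
    (hinj : Module.Injective A E) {X Y : Submodule A E} (h : Disjoint X Y) : X = ⊥ ∨ Y = ⊥ := by
  obtain ⟨C, hYC, hC⟩ := exists_maximal_disjoint h.symm
  obtain ⟨D, hXD, hD⟩ := exists_maximal_disjoint hC.prop.symm
  have hC' : Maximal (fun C : Submodule A E ↦ Disjoint C D) C :=
    ⟨hD.prop.symm, fun C' hC' hle ↦ hC.le_of_ge (hC'.mono_right hXD) hle⟩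
  rcases hind.2 C D (isCompl_of_maximal_disjoint hinj hC' hD) with h0 | h0
  · exact Or.inr (le_bot_iff.1 (h0 ▸ hYC))
  · exact Or.inl (le_bot_iff.1 (h0 ▸ hXD))

/-- In a uniform module, a nonzero submodule meets the intersection of finitely many nonzero
submodules nontrivially. -/
theorem IsIndecomposable.exists_eq_bot_of_finset (hind : IsIndecomposable A E)
    (hinj : Module.Injective A E) {ι : Type*} (s : Finset ι) (f : ι → Submodule A E)
    {X : Submodule A E} (h : X ⊓ s.inf f = ⊥) (hX : X ≠ ⊥) : ∃ i ∈ s, f i = ⊥ := by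
  classical
  induction s using Finset.induction_on with
  | empty => simp [hX] at h
  | insert i s hi ih =>
    rw [Finset.inf_insert, inf_left_comm] at h
    rcases hind.eq_bot_or_eq_bot hinj (disjoint_iff.2 h) with h0 | h0
    · exact ⟨i, Finset.mem_insert_self i s, h0⟩
    · obtain ⟨j, hj, hj0⟩ := ih h0
      exact ⟨j, Finset.mem_insert_of_mem hj, hj0⟩

/-- An injective endomorphism of an injective module splits, so it is bijective if the module is
indecomposable. -/
theorem IsIndecomposable.bijective_of_injective (hind : IsIndecomposable A E)
    (hinj : Module.Injective A E) (f : E →ₗ[A] E) (hf : Function.Injective f) :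
    Function.Bijective f := by
  refine ⟨hf, ?_⟩
  obtain ⟨g, hg⟩ := hinj.out f hf LinearMap.id
  have hdisj : Disjoint (LinearMap.range f) (LinearMap.ker g) := by
    rw [Submodule.disjoint_def]
    rintro _ ⟨x, rfl⟩ hx
    have hx0 : x = 0 := (hg x).symm.trans hx
    rw [hx0, map_zero]
  rcases hind.eq_bot_or_eq_bot hinj hdisj with h | h
  · obtain ⟨x, hx⟩ := @exists_ne E hind.1 0
    rw [LinearMap.range_eq_bot] at h
    exact absurd (hf (by rw [h]; rfl)) hx
  · exact fun y ↦ ⟨g y, LinearMap.ker_eq_bot.1 h (by rw [hg]; rfl)⟩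

end Uniform

/-! ### The Krull-Akizuki length bound -/

section KrullAkizuki

variable {R : Type*} [CommRing R] {M : Type*} [AddCommGroup M] [Module R M]

/-- The length of `Y / X` for submodules `X ≤ Y`. The image of `Y` in `M ⧸ X` is used instead of
a quotient of the subtype `Y`; for general `X` and `Y` this is the length of `(X + Y) / X`. -/
noncomputable def relLength (X Y : Submodule R M) : ℕ∞ := Module.length R (Y.map X.mkQ)

theorem relLength_add {X Y Z : Submodule R M} (hXY : X ≤ Y) (hYZ : Y ≤ Z) :
    relLength X Z = relLength X Y + relLength Y Z := by
  have hmap : ∀ x ∈ Z.map X.mkQ, Submodule.factor hXY x ∈ Z.map Y.mkQ := by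
    rintro _ ⟨z, hz, rfl⟩
    exact ⟨z, hz, by simp⟩
  refine Module.length_eq_add_of_exact (Submodule.inclusion (Submodule.map_mono hYZ))
    ((Submodule.factor hXY).restrict hmap) (Submodule.inclusion_injective _) ?_ ?_
  · rintro ⟨_, z, hz, rfl⟩
    exact ⟨⟨X.mkQ z, z, hz, rfl⟩, Subtype.ext (by simp)⟩
  · rintro ⟨_, z, hz, rfl⟩
    constructor
    · intro h
      have hzY : z ∈ Y := by simpa using congrArg Subtype.val h
      exact ⟨⟨X.mkQ z, z, hzY, rfl⟩, rfl⟩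
    · rintro ⟨⟨_, y, hy, rfl⟩, h⟩
      have h' : X.mkQ y = X.mkQ z := congrArg Subtype.val h
      refine Subtype.ext ?_
      change Submodule.factor hXY (X.mkQ z) = 0
      rw [← h']
      simpa using hy

theorem relLength_map_of_injective (f : M →ₗ[R] M) (hf : Function.Injective f)
    (X Y : Submodule R M) : relLength (X.map f) (Y.map f) = relLength X Y := by
  have hinj : Function.Injective (X.mapQ (X.map f) f (X.le_comap_map f)) := by
    rw [injective_iff_map_eq_zero]
    intro x
    induction x using Submodule.Quotient.induction_on with | _ x
    intro h
    rw [Submodule.mapQ_apply, Submodule.Quotient.mk_eq_zero] at h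
    obtain ⟨y, hy, hyx⟩ := h
    rw [Submodule.Quotient.mk_eq_zero, ← hf hyx]
    exact hy
  have heq : (Y.map f).map (X.map f).mkQ
      = (Y.map X.mkQ).map (X.mapQ (X.map f) f (X.le_comap_map f)) := by
    rw [← Submodule.map_comp, ← Submodule.map_comp, Submodule.mapQ_mkQ]
  rw [relLength, relLength, heq]
  exact (Submodule.equivMapOfInjective _ hinj _).length_eq.symm

/-- A finitely generated module killed by `b` has finite length if `R / b` has. -/
theorem isFiniteLength_of_fg_of_smul_eq_zero {b : R}
    (hb : IsFiniteLength R (R ⧸ Ideal.span {b})) [Module.Finite R M] (h : ∀ x : M, b • x = 0) :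
    IsFiniteLength R M := by
  obtain ⟨n, f, hf⟩ := Module.Finite.exists_fin' R M
  rw [isFiniteLength_iff_isNoetherian_isArtinian] at hb ⊢
  obtain ⟨_, _⟩ := hb
  let g : (Fin n → R ⧸ Ideal.span {b}) →ₗ[R] M :=
    ∑ i, (Submodule.liftQ (Ideal.span {b}) (LinearMap.toSpanSingleton R M (f (Pi.single i 1)))
      (by
        rw [Ideal.span, Submodule.span_singleton_le_iff_mem, LinearMap.mem_ker]
        exact h _)) ∘ₗ LinearMap.proj i
  have hg : Function.Surjective g := by
    intro y
    obtain ⟨x, rfl⟩ := hf y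
    refine ⟨fun i ↦ Submodule.Quotient.mk (x i), ?_⟩
    conv_rhs => rw [pi_eq_sum_univ' x]
    simp only [g, LinearMap.sum_apply, map_sum, map_smul]
    rfl
  exact ⟨isNoetherian_of_surjective g (LinearMap.range_eq_top.2 hg),
    isArtinian_of_surjective _ g hg⟩

/-- The length bound in the Krull-Akizuki theorem, for modules: let `M₀ ≤ M` be finitely generated
with torsion quotient. All finitely generated `N` between `M₀` and `M` have `N / aN` of length at
most that of `M₀ / aM₀`, so the images of these `N` in `M / aM` have bounded length, and an image
of maximal length is everything. -/
theorem isFiniteLength_quotient_smul [IsNoetherianRing R] [Ring.KrullDimLE 1 R] {a : R}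
    (ha : a ∈ nonZeroDivisors R) (haM : Function.Injective (fun x : M ↦ a • x))
    {M₀ : Submodule R M} (hM₀ : M₀.FG)
    (htor : ∀ x : M, ∃ b ∈ nonZeroDivisors R, b • x ∈ M₀) :
    IsFiniteLength R (M ⧸ LinearMap.range (LinearMap.lsmul R M a)) := by
  classical
  set f : M →ₗ[R] M := LinearMap.lsmul R M a with hf
  have hfinj : Function.Injective f := haM
  have htor' : ∀ N : Submodule R M, N.FG → ∃ b ∈ nonZeroDivisors R, ∀ x ∈ N, b • x ∈ M₀ := by
    rintro _ ⟨s, rfl⟩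
    choose b hb hbM using htor
    refine ⟨∏ x ∈ s, b x, prod_mem fun x _ ↦ hb x, fun x hx ↦ ?_⟩
    have : Submodule.span R (s : Set M) ≤ M₀.comap (LinearMap.lsmul R M (∏ x ∈ s, b x)) := by
      rw [Submodule.span_le]
      intro x hx
      rw [SetLike.mem_coe, Submodule.mem_comap, LinearMap.lsmul_apply,
        ← Finset.prod_erase_mul s b hx, mul_smul]
      exact M₀.smul_mem _ (hbM x)
    exact this hx
  have hrel : ∀ N : Submodule R M, N.FG → relLength M₀ N ≠ ⊤ := by
    intro N hN
    obtain ⟨b, hb, hbN⟩ := htor' N hN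
    have : Module.Finite R (N.map M₀.mkQ) := Module.Finite.iff_fg.2 (hN.map _)
    refine Module.length_ne_top_iff.2 (isFiniteLength_of_fg_of_smul_eq_zero
      (isFiniteLength_quotient_span_singleton R hb) ?_)
    rintro ⟨_, x, hx, rfl⟩
    refine Subtype.ext ?_
    change b • M₀.mkQ x = 0
    rw [← map_smul]
    exact (Submodule.Quotient.mk_eq_zero _).2 (hbN x hx)
  have hle : ∀ N : Submodule R M, N.map f ≤ N := by
    rintro N _ ⟨x, hx, rfl⟩
    exact N.smul_mem a hx
  have hM₀fin : relLength (M₀.map f) M₀ ≠ ⊤ := by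
    have : Module.Finite R (M₀.map (M₀.map f).mkQ) := Module.Finite.iff_fg.2 (hM₀.map _)
    refine Module.length_ne_top_iff.2 (isFiniteLength_of_fg_of_smul_eq_zero
      (isFiniteLength_quotient_span_singleton R ha) ?_)
    rintro ⟨_, x, hx, rfl⟩
    refine Subtype.ext ?_
    change a • (M₀.map f).mkQ x = 0
    rw [← map_smul]
    exact (Submodule.Quotient.mk_eq_zero _).2 ⟨x, hx, rfl⟩
  have hbound : ∀ N : Submodule R M, N.FG → M₀ ≤ N →
      Module.length R (N.map (LinearMap.range f).mkQ) ≤ relLength (M₀.map f) M₀ := by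
    intro N hN hMN
    -- compare the chains `aM₀ ≤ M₀ ≤ N` and `aM₀ ≤ aN ≤ N`
    have h1 := relLength_add (hle M₀) hMN
    rw [relLength_add (Submodule.map_mono hMN) (hle N), relLength_map_of_injective f hfinj,
      add_comm, (ENat.addLECancellable_of_ne_top (hrel N hN)).inj_left] at h1
    rw [← h1]
    have hfac : N.map f ≤ LinearMap.range f := LinearMap.map_le_range
    have hmap : ∀ x ∈ N.map (N.map f).mkQ,
        Submodule.factor hfac x ∈ N.map (LinearMap.range f).mkQ := by
      rintro _ ⟨z, hz, rfl⟩
      exact ⟨z, hz, by simp⟩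
    refine Module.length_le_of_surjective ((Submodule.factor hfac).restrict hmap) ?_
    rintro ⟨_, z, hz, rfl⟩
    exact ⟨⟨(N.map f).mkQ z, z, hz, rfl⟩, Subtype.ext (by simp)⟩
  -- a finitely generated `N ≥ M₀` whose image in `M / aM` has maximal length
  have hmax : ∃ N : Submodule R M, N.FG ∧ M₀ ≤ N ∧ ∀ N' : Submodule R M, N'.FG → N ≤ N' →
      Module.length R (N'.map (LinearMap.range f).mkQ) ≤
        Module.length R (N.map (LinearMap.range f).mkQ) := by
    let S : Set ℕ∞ := {l | ∃ N : Submodule R M, N.FG ∧ M₀ ≤ N ∧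
      Module.length R (N.map (LinearMap.range f).mkQ) = l}
    have hS : S.Finite := by
      obtain ⟨c, hc⟩ := ENat.ne_top_iff_exists.1 hM₀fin
      refine ((Set.finite_Iic c).image (fun n : ℕ ↦ (n : ℕ∞))).subset ?_
      rintro _ ⟨N, hN, hMN, rfl⟩
      have h := hbound N hN hMN
      rw [← hc] at h
      obtain ⟨d, hd⟩ := ENat.ne_top_iff_exists.1 (ne_top_of_le_ne_top (ENat.natCast_ne_top c) h)
      rw [← hd] at h ⊢
      exact ⟨d, by exact_mod_cast h, rfl⟩
    obtain ⟨l, ⟨N, hN, hMN, rfl⟩, hl⟩ := hS.exists_maximal ⟨_, M₀, hM₀, le_rfl, rfl⟩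
    refine ⟨N, hN, hMN, fun N' hN' hNN' ↦ ?_⟩
    exact (le_total _ _).elim (fun h ↦ h) (hl ⟨N', hN', hMN.trans hNN', rfl⟩)
  obtain ⟨N, hN, hMN, hNmax⟩ := hmax
  have hfl : ∀ N : Submodule R M, N.FG → M₀ ≤ N →
      IsFiniteLength R (N.map (LinearMap.range f).mkQ) := fun N hN hMN ↦
    Module.length_ne_top_iff.1 (ne_top_of_le_ne_top hM₀fin (hbound N hN hMN))
  have htop : N.map (LinearMap.range f).mkQ = ⊤ := by
    rw [eq_top_iff]
    rintro y -
    obtain ⟨x, rfl⟩ := Submodule.mkQ_surjective _ y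
    let N' := N ⊔ Submodule.span R {x}
    have hN' : N'.FG := hN.sup (Submodule.fg_span_singleton x)
    have hNN' : N ≤ N' := le_sup_left
    have hfl' := isFiniteLength_iff_isNoetherian_isArtinian.1 (hfl N' hN' (hMN.trans hNN'))
    by_contra hx
    have hlt : N.map (LinearMap.range f).mkQ < N'.map (LinearMap.range f).mkQ := by
      refine lt_of_le_of_ne (Submodule.map_mono hNN') fun h ↦ hx ?_
      rw [h]
      exact ⟨x, Submodule.mem_sup_right (Submodule.mem_span_singleton_self x), rfl⟩
    have := hNmax N' hN' hNN'
    rw [Module.length_submodule, Module.length_submodule] at this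
    refine this.not_gt (Order.height_strictMono hlt ?_)
    rw [← Module.length_submodule]
    exact (Module.length_ne_top_iff.2 (hfl N hN hMN)).lt_top
  have := Module.length_ne_top_iff.2 (hfl N hN hMN)
  rw [htop, Module.length_top] at this
  exact Module.length_ne_top_iff.1 this

end KrullAkizuki

/-! ### Minimal primes and zero divisors of a reduced ring -/

section MinimalPrimes

variable {R : Type*} [CommRing R]

theorem IsPseudoNoetherianRing.finite_minimalPrimes_ring (hR : IsPseudoNoetherianRing R) :
    (minimalPrimes R).Finite := by
  have h := hR.finite_minimalPrimes 0
  rwa [Ideal.span_singleton_zero] at h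

theorem eq_zero_of_forall_mem_minimalPrimes [IsReduced R] {x : R}
    (h : ∀ n ∈ minimalPrimes R, x ∈ n) : x = 0 := by
  have hx : x ∈ sInf (minimalPrimes R) := Ideal.mem_sInf.2 fun {n} hn ↦ h n hn
  rw [minimalPrimes, Ideal.sInf_minimalPrimes] at hx
  obtain ⟨k, hk⟩ := hx
  exact eq_zero_of_pow_eq_zero hk

theorem mem_nonZeroDivisors_of_forall_notMem_minimalPrimes [IsReduced R] {r : R}
    (h : ∀ n ∈ minimalPrimes R, r ∉ n) : r ∈ nonZeroDivisors R := by
  rw [mem_nonZeroDivisors_iff_right]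
  intro x hx
  exact eq_zero_of_forall_mem_minimalPrimes fun n hn ↦
    (hn.1.1.mem_or_mem (hx ▸ n.zero_mem : x * r ∈ n)).resolve_right (h n hn)

/-- By prime avoidance, a prime consisting of zero divisors of a reduced ring with finitely many
minimal primes is minimal. -/
theorem mem_minimalPrimes_of_disjoint_nonZeroDivisors [IsReduced R] (hfin : (minimalPrimes R).Finite)
    {q : Ideal R} [hq : q.IsPrime] (h : ∀ r ∈ q, r ∉ nonZeroDivisors R) : q ∈ minimalPrimes R := by
  have hsub : (q : Set R) ⊆ ⋃ n ∈ (hfin.toFinset : Set (Ideal R)), (n : Set R) := by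
    intro r hr
    by_contra hr'
    refine h r hr (mem_nonZeroDivisors_of_forall_notMem_minimalPrimes fun n hn hrn ↦ hr' ?_)
    exact Set.mem_biUnion (hfin.mem_toFinset.2 hn) hrn
  obtain ⟨n, hn, hle⟩ := (Ideal.subset_union_prime (f := fun n : Ideal R ↦ n) ⊥ ⊥
    fun n hn _ _ ↦ (hfin.mem_toFinset.1 hn).1.1).1 hsub
  rw [hfin.mem_toFinset] at hn
  rwa [hle.antisymm (hn.2 ⟨hq, bot_le⟩ hle)]

/-- A torsion free module over a reduced ring with finitely many minimal primes: the kernel of the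
localization map at a minimal prime `n` is killed by a single element `t ∉ n`, namely any `t` in
all the other minimal primes. -/
theorem exists_smul_eq_zero_of_mem_minimalPrimes [IsReduced R] (hfin : (minimalPrimes R).Finite)
    {n : Ideal R} (hn : n ∈ minimalPrimes R) (M : Type*) [AddCommGroup M] [Module R M]
    [Module.IsTorsionFree R M] :
    ∃ t ∉ n, ∀ x : M, (∃ s ∉ n, s • x = 0) → t • x = 0 := by
  classical
  have hnp : n.IsPrime := hn.1.1
  set T : Finset (Ideal R) := hfin.toFinset.erase n
  have hT : ∀ m ∈ T, m ∈ minimalPrimes R ∧ m ≠ n := fun m hm ↦ by simpa [T, and_comm] using hm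
  have hT' : ∀ m ∈ minimalPrimes R, m ≠ n → m ∈ T := fun m hm hne ↦ by simp [T, hm, hne]
  obtain ⟨t, ht, htn⟩ : ∃ t ∈ T.inf id, t ∉ n := by
    by_contra! hle
    obtain ⟨m, hm, hmn⟩ := (Ideal.IsPrime.inf_le' hnp).1 (show T.inf id ≤ n from hle)
    exact (hT m hm).2 (hmn.antisymm (hn.2 ⟨(hT m hm).1.1.1, bot_le⟩ hmn))
  have ht' : ∀ m ∈ T, t ∈ m := fun m hm ↦ (Finset.inf_le hm : T.inf id ≤ m) ht
  obtain ⟨u, hun, hu⟩ : ∃ u ∈ n, ∀ m ∈ T, u ∉ m := by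
    by_contra! hsub
    obtain ⟨m, hm, hnm⟩ := (Ideal.subset_union_prime (s := T) (f := fun n : Ideal R ↦ n) (I := n) ⊥ ⊥
      fun m hm _ _ ↦ (hT m hm).1.1.1).1 fun r hr ↦ by
        obtain ⟨m, hm, hrm⟩ := hsub r hr
        exact Set.mem_biUnion (Finset.mem_coe.2 hm) hrm
    exact (hT m hm).2 (((hT m hm).1.2 ⟨hnp, bot_le⟩ hnm).antisymm hnm)
  refine ⟨t, htn, fun x ⟨s, hs, hsx⟩ ↦ ?_⟩
  -- `s * t + u` lies in no minimal prime, and it kills `t • x`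
  have hreg : s * t + u ∈ nonZeroDivisors R := by
    refine mem_nonZeroDivisors_of_forall_notMem_minimalPrimes fun m hm hmem ↦ ?_
    rcases eq_or_ne m n with rfl | hne
    · exact (hnp.mem_or_mem ((Ideal.add_mem_iff_left _ hun).1 hmem)).elim hs htn
    · exact hu m (hT' m hm hne)
        ((Ideal.add_mem_iff_right _ (m.mul_mem_left s (ht' m (hT' m hm hne)))).1 hmem)
  have hut : u * t = 0 := by
    refine eq_zero_of_forall_mem_minimalPrimes fun m hm ↦ ?_
    rcases eq_or_ne m n with rfl | hne
    · exact m.mul_mem_right t hun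
    · exact m.mul_mem_left u (ht' m (hT' m hm hne))
  have hinj : IsSMulRegular M (s * t + u) :=
    Module.IsTorsionFree.isSMulRegular (isRegular_iff_mem_nonZeroDivisors.2 hreg)
  refine hinj ?_
  dsimp only
  rw [smul_zero, add_smul, smul_smul u, hut, zero_smul, add_zero, smul_smul,
    show s * t * t = t * t * s by ring, mul_smul, hsx, smul_zero]

theorem mem_minimalPrimes_span_singleton_of_height_eq_one {p : Ideal R} [hp : p.IsPrime]
    (hht : p.height = 1) {a : R} (ha : a ∈ nonZeroDivisors R) (hap : a ∈ p) :
    p ∈ (Ideal.span {a}).minimalPrimes := by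
  refine ⟨⟨hp, (Ideal.span_singleton_le_iff_mem p).2 hap⟩, fun q ⟨hq, haq⟩ hqp ↦ ?_⟩
  by_contra hpq
  have h := (Ideal.height_le_iff (n := 1)).1 (le_of_eq hht) q hq (lt_of_le_not_ge hqp hpq)
  rw [Nat.cast_one, Order.lt_one_iff, Ideal.height_eq_zero_iff] at h
  exact notMem_nonZeroDivisors_of_mem_mem_minimalPrimes
    ((Ideal.span_singleton_le_iff_mem q).1 haq) h ha

end MinimalPrimes

/-! ### Localizations of algebras and their modules -/

section Localization

variable {R : Type*} [CommRing R] {A : Type*} [Ring A] [Algebra R A] (S : Submonoid R)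

instance isScalarTower_localization :
    IsScalarTower (Localization S) (LocalizedModule S A) (LocalizedModule S A) where
  smul_assoc r x y := by
    induction r using Localization.induction_on with | _ r
    induction x, y using LocalizedModule.induction_on₂ with | _ a b s t
    rw [smul_eq_mul, smul_eq_mul, LocalizedModule.mk_mul_mk, LocalizedModule.mk_smul_mk,
      LocalizedModule.mk_smul_mk, LocalizedModule.mk_mul_mk, mul_assoc, smul_mul_assoc]

section Module

variable {E : Type*} [AddCommGroup E] [Module R E] [Module A E] [IsScalarTower R A E]

theorem isUnit_algebraMap_end_end (hS : ∀ s ∈ S, Function.Bijective (fun x : E ↦ s • x)) (s : S) :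
    IsUnit (algebraMap R (Module.End R (Module.End R E)) s) := by
  have h : IsUnit (algebraMap R (Module.End R E) s) := (Module.End.isUnit_iff _).2 (hS s s.2)
  have h2 := h.map (Algebra.lmul R (Module.End R E))
  rwa [AlgHom.commutes] at h2

/-- The additive map underlying the action of `S⁻¹A` on an `A`-module on which `S` acts
bijectively. -/
noncomputable def localizedActionMap (hS : ∀ s ∈ S, Function.Bijective (fun x : E ↦ s • x)) :
    LocalizedModule S A →ₗ[R] Module.End R E :=
  LocalizedModule.lift S (Algebra.lsmul R R E : A →ₐ[R] Module.End R E).toLinearMap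
    (isUnit_algebraMap_end_end S hS)

theorem smul_localizedActionMap_mk (hS : ∀ s ∈ S, Function.Bijective (fun x : E ↦ s • x))
    (a : A) (s : S) :
    (s : R) • localizedActionMap S hS (LocalizedModule.mk a s) = Algebra.lsmul R R E a := by
  rw [localizedActionMap, LocalizedModule.lift_mk]
  exact ((Module.End.algebraMap_isUnit_inv_apply_eq_iff (R := R) (S := R)
    (isUnit_algebraMap_end_end S hS s) _ _).1 rfl).symm

/-- The action of `S⁻¹A` on an `A`-module on which `S` acts bijectively. -/
noncomputable def localizedActionHom (hS : ∀ s ∈ S, Function.Bijective (fun x : E ↦ s • x)) :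
    LocalizedModule S A →+* Module.End R E where
  __ := localizedActionMap S hS
  map_zero' := by
    change localizedActionMap S hS 0 = 0
    exact map_zero _
  map_one' := by
    have h := smul_localizedActionMap_mk S hS (1 : A) 1
    rw [Submonoid.coe_one, one_smul, map_one] at h
    rw [OreLocalization.one_def]
    exact h
  map_mul' x y := by
    induction x, y using LocalizedModule.induction_on₂ with | _ a b s t
    refine ((Module.End.isUnit_iff _).1 (isUnit_algebraMap_end_end S hS (s * t))).1 ?_
    change ((s * t : S) : R) • localizedActionMap S hS _
      = ((s * t : S) : R) • (localizedActionMap S hS _ * localizedActionMap S hS _)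
    rw [LocalizedModule.mk_mul_mk, smul_localizedActionMap_mk, map_mul, Submonoid.coe_mul,
      ← smul_mul_smul_comm, smul_localizedActionMap_mk, smul_localizedActionMap_mk]

/-- An `A`-module on which `S` acts bijectively, as an `S⁻¹A`-module. -/
noncomputable abbrev localizedActionModule
    (hS : ∀ s ∈ S, Function.Bijective (fun x : E ↦ s • x)) : Module (LocalizedModule S A) E :=
  Module.compHom E (localizedActionHom (A := A) S hS)

theorem localizedActionModule_mk_one_smul
    (hS : ∀ s ∈ S, Function.Bijective (fun x : E ↦ s • x)) (a : A) (x : E) :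
    letI := localizedActionModule (A := A) S hS
    (LocalizedModule.mk a 1 : LocalizedModule S A) • x = a • x := by
  have h := smul_localizedActionMap_mk S hS a 1
  rw [Submonoid.coe_one, one_smul] at h
  exact congrArg (fun f : Module.End R E ↦ f x) h

end Module

theorem mk_one_mem_span_image (O : Type*) [Semiring O] [Module O (LocalizedModule S A)]
    [SMul R O] [IsScalarTower R O (LocalizedModule S A)] {s : Set A} {x : A}
    (hx : x ∈ Submodule.span R s) :
    (LocalizedModule.mk x 1 : LocalizedModule S A) ∈
      Submodule.span O ((fun a : A ↦ (LocalizedModule.mk a 1 : LocalizedModule S A)) '' s) := by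
  induction hx using Submodule.span_induction with
  | mem x hx => exact Submodule.subset_span ⟨x, hx, rfl⟩
  | zero => rw [LocalizedModule.zero_mk]; exact Submodule.zero_mem _
  | add x y _ _ hx hy =>
    have h := Submodule.add_mem _ hx hy
    rwa [LocalizedModule.mk_add_mk, one_smul, one_smul, mul_one] at h
  | smul r x _ hx =>
    rw [← LocalizedModule.smul'_mk]
    exact Submodule.smul_of_tower_mem _ r hx

/-- If `S⁻¹A` is finite over `S⁻¹R`, then finitely many elements of `A` generate `A` up to
`S`-torsion. -/
theorem exists_finset_forall_smul_mem_span
    (h : Module.Finite (Localization S) (LocalizedModule S A)) :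
    ∃ s : Finset A, ∀ x : A, ∃ t ∈ S, t • x ∈ Submodule.span R (s : Set A) := by
  classical
  obtain ⟨G, hG⟩ := h.fg_top
  have hnum : ∀ y : LocalizedModule S A, ∃ a : A, ∃ t : S, t • y = LocalizedModule.mk a 1 := by
    intro y
    induction y using LocalizedModule.induction_on with | _ a t
    exact ⟨a, t, by
      rw [Submonoid.smul_def, LocalizedModule.smul'_mk, ← Submonoid.smul_def,
        LocalizedModule.mk_cancel]⟩
  choose num den hnum using hnum
  set N := Submodule.span R ((G.image num : Finset A) : Set A) with hN
  have key : ∀ y ∈ Submodule.span (Localization S) (G : Set (LocalizedModule S A)),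
      ∃ t : S, ∃ a ∈ N, t • y = LocalizedModule.mk a 1 := by
    intro y hy
    induction hy using Submodule.span_induction with
    | mem y hy =>
      exact ⟨den y, num y, Submodule.subset_span (by simpa using ⟨y, hy, rfl⟩), hnum y⟩
    | zero => exact ⟨1, 0, N.zero_mem, by rw [smul_zero, LocalizedModule.zero_mk]⟩
    | add y z _ _ hy hz =>
      obtain ⟨t, a, ha, hya⟩ := hy
      obtain ⟨u, b, hb, hzb⟩ := hz
      refine ⟨t * u, (u : R) • a + (t : R) • b,
        N.add_mem (N.smul_mem _ ha) (N.smul_mem _ hb), ?_⟩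
      rw [smul_add, mul_comm, mul_smul, hya, mul_comm, mul_smul, hzb, Submonoid.smul_def,
        Submonoid.smul_def, LocalizedModule.smul'_mk, LocalizedModule.smul'_mk,
        LocalizedModule.mk_add_mk, one_smul, one_smul, mul_one]
    | smul c y _ hy =>
      obtain ⟨t, a, ha, hya⟩ := hy
      induction c using Localization.induction_on with | _ c
      obtain ⟨r, s⟩ := c
      refine ⟨s * t, r • a, N.smul_mem _ ha, ?_⟩
      rw [← LocalizedModule.smul'_mk, ← hya]
      induction y using LocalizedModule.induction_on with | _ b u
      rw [LocalizedModule.mk_smul_mk, Submonoid.smul_def, Submonoid.smul_def,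
        LocalizedModule.smul'_mk, LocalizedModule.smul'_mk, LocalizedModule.smul'_mk,
        Submonoid.coe_mul, mul_smul, smul_comm (t : R) r b, ← Submonoid.smul_def,
        LocalizedModule.mk_cancel_common_left]
  refine ⟨G.image num, fun x ↦ ?_⟩
  obtain ⟨t, a, ha, hta⟩ := key (LocalizedModule.mk x 1) (hG ▸ Submodule.mem_top)
  rw [Submonoid.smul_def, LocalizedModule.smul'_mk, LocalizedModule.mk_eq] at hta
  obtain ⟨u, hu⟩ := hta
  rw [one_smul, one_smul] at hu
  refine ⟨u * t, S.mul_mem u.2 t.2, ?_⟩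
  rw [mul_smul]
  change u • (t : R) • x ∈ N
  rw [hu]
  exact N.smul_mem _ ha

end Localization

/-! ### Semiprime rings -/

section Semiprime

/-- The left ideal generated by `aA` is two-sided, and its square is zero if `aAa = 0`. -/
theorem eq_zero_of_forall_mul_mul_eq_zero {A : Type*} [Ring A] (hA : HasNoNilpotentIdeals A)
    {a : A} (ha : ∀ b, a * b * a = 0) : a = 0 := by
  let I : Ideal A := Ideal.span (Set.range fun b ↦ a * b)
  have hI : I.IsTwoSided := ⟨fun {x} c hx ↦ by
    induction hx using Submodule.span_induction with
    | mem x hx =>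
      obtain ⟨b, rfl⟩ := hx
      exact Submodule.subset_span ⟨b * c, (mul_assoc _ _ _).symm⟩
    | zero => rw [zero_mul]; exact I.zero_mem
    | add x y _ _ hx hy => rw [add_mul]; exact I.add_mem hx hy
    | smul d x _ hx => rw [smul_eq_mul, mul_assoc]; exact I.mul_mem_left d hx⟩
  have hxa : ∀ x ∈ I, x * a = 0 := by
    intro x hx
    induction hx using Submodule.span_induction with
    | mem x hx => obtain ⟨b, rfl⟩ := hx; exact ha b
    | zero => exact zero_mul a
    | add x y _ _ hx hy => rw [add_mul, hx, hy, add_zero]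
    | smul d x _ hx => rw [smul_eq_mul, mul_assoc, hx, mul_zero]
  have hxy : ∀ y ∈ I, ∀ x ∈ I, x * y = 0 := by
    intro y hy
    induction hy using Submodule.span_induction with
    | mem y hy =>
      obtain ⟨b, rfl⟩ := hy
      intro x hx
      rw [← mul_assoc, hxa x hx, zero_mul]
    | zero => exact fun x _ ↦ mul_zero x
    | add y z _ _ hy hz => exact fun x hx ↦ by rw [mul_add, hy x hx, hz x hx, add_zero]
    | smul d y _ hy =>
      exact fun x hx ↦ by rw [smul_eq_mul, ← mul_assoc, hy _ (I.mul_mem_right d hx)]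
  have hnil : IsNilpotent I := by
    refine ⟨2, ?_⟩
    rw [Submodule.pow_succ, Submodule.pow_one]
    exact le_bot_iff.1 (Ideal.mul_le.2 fun x hx y hy ↦ by
      rw [hxy y hy x hx]; exact Submodule.zero_mem _)
  have h0 := hA I hI hnil
  have haI : a ∈ I := Submodule.subset_span ⟨1, mul_one a⟩
  rw [h0] at haI
  exact haI

/-- A left artinian ring is semisimple if it is semiprime, which is stated elementwise. -/
theorem isSemisimpleRing_of_forall_mul_mul_eq_zero {B : Type*} [Ring B] [IsArtinianRing B]
    (h : ∀ x : B, (∀ y, x * y * x = 0) → x = 0) : IsSemisimpleRing B := by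
  rw [IsArtinianRing.isSemisimpleRing_iff_jacobson]
  have hsq : ∀ I : Ideal B, I * I = ⊥ → I = ⊥ := by
    refine fun I hI ↦ (Submodule.eq_bot_iff I).2 fun x hx ↦ h x fun y ↦ ?_
    rw [mul_assoc]
    have := Ideal.mul_mem_mul hx (I.mul_mem_left y hx)
    rw [hI] at this
    exact this
  have hpow : ∀ (I : Ideal B) (n : ℕ), I ^ (n + 1) = ⊥ → I = ⊥ := by
    intro I n
    induction n with
    | zero => exact fun hI ↦ by rwa [zero_add, Submodule.pow_one] at hI
    | succ n ih =>
      refine fun hI ↦ ih (hsq _ (le_bot_iff.1 (Ideal.mul_le.2 fun x hx y hy ↦ ?_)))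
      have hle : I ^ (n + 1) ≤ I := by
        rcases Nat.eq_zero_or_pos n with rfl | hn
        · rw [zero_add, Submodule.pow_one]
        · rw [Submodule.pow_succ]
          exact Ideal.mul_le.2 fun a _ b hb ↦ I.mul_mem_left a hb
      rw [← hI, Submodule.pow_succ I]
      exact Ideal.mul_mem_mul hx (hle hy)
  obtain ⟨n, hn⟩ := IsSemiprimaryRing.isNilpotent (R := B)
  refine hpow _ n ?_
  rw [Submodule.pow_succ, hn]
  exact le_bot_iff.1 (Ideal.mul_le.2 fun x hx y _ ↦ by
    rw [(Submodule.mem_bot B).1 hx, zero_mul]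
    exact Submodule.zero_mem _)

end Semiprime

/-! ### Localizations of a reduced pseudo-noetherian order -/

section Order

variable {R : Type u} [CommRing R] {A : Type v} [Ring A] [Algebra R A]

/-- Up to torsion, the localization of an order at a prime is finitely generated. -/
theorem IsReducedPseudoNoetherianOrder.exists_fg (hA : IsReducedPseudoNoetherianOrder R A)
    (p : PrimeSpectrum R) :
    ∃ M₀ : Submodule (Localization.AtPrime p.asIdeal) (LocAlg A p), M₀.FG ∧
      ∀ x : LocAlg A p, ∃ t ∈ nonZeroDivisors R,
        algebraMap R (Localization.AtPrime p.asIdeal) t • x ∈ M₀ := by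
  obtain ⟨s, hs⟩ := exists_finset_forall_smul_mem_span _ hA.finite_total
  refine ⟨Submodule.span _ ((fun a : A ↦ (LocalizedModule.mk a 1 : LocAlg A p)) '' s),
    Submodule.fg_span (s.finite_toSet.image _), fun x ↦ ?_⟩
  induction x using LocalizedModule.induction_on with | _ a u
  obtain ⟨t, ht, hta⟩ := hs a
  refine ⟨t, ht, ?_⟩
  have h := Submodule.smul_mem _ (Localization.mk 1 u : Localization.AtPrime p.asIdeal)
    (mk_one_mem_span_image (S := p.asIdeal.primeCompl) (Localization.AtPrime p.asIdeal) hta)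
  rw [LocalizedModule.mk_smul_mk, one_smul, mul_one] at h
  rwa [algebraMap_smul, LocalizedModule.smul'_mk]

theorem IsReducedPseudoNoetherianOrder.isFiniteLength_quotient
    (hR : IsPseudoNoetherianRing R) (hA : IsReducedPseudoNoetherianOrder R A)
    {p : PrimeSpectrum R} (hp : p.asIdeal.height = 1) {a : R} (ha : a ∈ nonZeroDivisors R)
    (hap : a ∈ p.asIdeal) :
    IsFiniteLength (Localization.AtPrime p.asIdeal) (LocAlg A p ⧸
      LinearMap.range (LinearMap.lsmul (Localization.AtPrime p.asIdeal) (LocAlg A p)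
        (algebraMap R (Localization.AtPrime p.asIdeal) a))) := by
  have : IsNoetherianRing (Localization.AtPrime p.asIdeal) :=
    hR.noetherian_atPrime a p (mem_minimalPrimes_span_singleton_of_height_eq_one hp ha hap)
  have : Ring.KrullDimLE 1 (Localization.AtPrime p.asIdeal) := by
    rw [Ring.KrullDimLE, Order.krullDimLE_iff]
    change ringKrullDim (Localization.AtPrime p.asIdeal) ≤ _
    rw [IsLocalization.AtPrime.ringKrullDim_eq_height p.asIdeal, hp]
    rfl
  have hreg : ∀ t ∈ nonZeroDivisors R,
      algebraMap R (Localization.AtPrime p.asIdeal) t ∈ nonZeroDivisors _ := fun t ht ↦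
    IsLocalization.map_nonZeroDivisors_le p.asIdeal.primeCompl _ ⟨t, ht, rfl⟩
  obtain ⟨M₀, hM₀, htor⟩ := hA.exists_fg p
  refine isFiniteLength_quotient_smul (hreg a ha) ?_ hM₀ fun x ↦ ?_
  · have hinj : IsSMulRegular A a :=
      hA.torsionFree.isSMulRegular (isRegular_iff_mem_nonZeroDivisors.2 ha)
    intro x y hxy
    dsimp only at hxy
    rw [algebraMap_smul, algebraMap_smul] at hxy
    induction x, y using LocalizedModule.induction_on₂ with | _ b c s t
    rw [LocalizedModule.smul'_mk, LocalizedModule.smul'_mk, LocalizedModule.mk_eq] at hxy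
    obtain ⟨v, hv⟩ := hxy
    refine LocalizedModule.mk_eq.2 ⟨v, hinj ?_⟩
    simp only [Submonoid.smul_def] at hv ⊢
    rwa [smul_comm a (v : R), smul_comm a (t : R), smul_comm a (v : R), smul_comm a (s : R)]
  · obtain ⟨t, ht, htx⟩ := htor x
    exact ⟨_, hreg t ht, htx⟩

/-- At a minimal prime `n` of `R`, the ring `A_n` is finite over the artinian ring `R_n`, and it
is semiprime because the kernel of `A → A_n` is killed by a single element of `R \ n`. -/
theorem IsReducedPseudoNoetherianOrder.isSemisimpleRing_locAlg [IsReduced R]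
    (hR : IsPseudoNoetherianRing R) (hA : IsReducedPseudoNoetherianOrder R A)
    {n : PrimeSpectrum R} (hn : n.asIdeal ∈ minimalPrimes R) : IsSemisimpleRing (LocAlg A n) := by
  have : IsNoetherianRing (Localization.AtPrime n.asIdeal) :=
    hR.noetherian_atPrime 0 n (by rwa [Ideal.span_singleton_zero])
  have : Ring.KrullDimLE 0 (Localization.AtPrime n.asIdeal) := .of_isLocalization _ hn _
  have : IsArtinianRing (Localization.AtPrime n.asIdeal) :=
    isArtinianRing_iff_krullDimLE_zero.2 inferInstance
  obtain ⟨M₀, hM₀, htor⟩ := hA.exists_fg n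
  have htop : M₀ = ⊤ := by
    refine eq_top_iff.2 fun x _ ↦ ?_
    obtain ⟨t, ht, htx⟩ := htor x
    have htn : t ∈ n.asIdeal.primeCompl := fun h ↦
      notMem_nonZeroDivisors_of_mem_mem_minimalPrimes h hn ht
    exact (M₀.smul_mem_iff_of_isUnit
      (IsLocalization.map_units (Localization.AtPrime n.asIdeal) ⟨t, htn⟩)).1 htx
  have : Module.Finite (Localization.AtPrime n.asIdeal) (LocAlg A n) := ⟨htop ▸ hM₀⟩
  have : IsArtinian (Localization.AtPrime n.asIdeal) (LocAlg A n) :=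
    isArtinian_of_fg_of_artinian'
  have : IsArtinianRing (LocAlg A n) := isArtinian_of_tower (Localization.AtPrime n.asIdeal) this
  refine isSemisimpleRing_of_forall_mul_mul_eq_zero fun x hx ↦ ?_
  have := hA.torsionFree
  obtain ⟨t, htn, ht⟩ := exists_smul_eq_zero_of_mem_minimalPrimes hR.finite_minimalPrimes_ring hn A
  induction x using LocalizedModule.induction_on with | _ a s
  have hta : t • a = 0 := by
    refine eq_zero_of_forall_mul_mul_eq_zero hA.reduced fun b ↦ ?_
    have h := hx (LocalizedModule.mk b 1)
    rw [LocalizedModule.mk_mul_mk, LocalizedModule.mk_mul_mk,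
      ← LocalizedModule.zero_mk (s * 1 * s), LocalizedModule.mk_eq] at h
    obtain ⟨v, hv⟩ := h
    rw [smul_zero, smul_zero, ← mul_smul] at hv
    have h0 := ht (a * b * a) ⟨_, (v * (s * 1 * s)).2, hv⟩
    rw [smul_mul_assoc, smul_mul_assoc, mul_smul_comm, h0, smul_zero]
  rw [← LocalizedModule.zero_mk s, LocalizedModule.mk_eq]
  refine ⟨⟨t, htn⟩, ?_⟩
  rw [smul_zero, smul_zero, smul_comm]
  exact (congrArg (fun y ↦ (s : R) • y) hta).trans (smul_zero _)

end Order

/-! ### Simple submodules -/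

section Simple

/-- If an `O`-submodule of finite colength in `B` annihilates `x ≠ 0`, then the `B`-module
generated by `x` is artinian and so contains a simple submodule. -/
theorem exists_isSimpleModule {O B E : Type*} [CommRing O] [Ring B] [Module O B]
    [IsScalarTower O B B] [AddCommGroup E] [Module B E] {N : Submodule O B}
    (hN : IsFiniteLength O (B ⧸ N)) {x : E} (hx : x ≠ 0) (hNx : ∀ b ∈ N, b • x = 0) :
    ∃ W : Submodule B E, IsSimpleModule B W := by
  let f : B →ₗ[B] E := LinearMap.toSpanSingleton B E x
  have hle : N ≤ (LinearMap.ker f).restrictScalars O := hNx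
  have := (isFiniteLength_iff_isNoetherian_isArtinian.1 hN).2
  have h0 : IsArtinian O (B ⧸ (LinearMap.ker f).restrictScalars O) :=
    isArtinian_of_surjective _ (Submodule.factor hle) (Submodule.factor_surjective hle)
  have h1 : IsArtinian O (B ⧸ LinearMap.ker f) :=
    isArtinian_of_linearEquiv (Submodule.Quotient.restrictScalarsEquiv O (LinearMap.ker f))
  have h2 : IsArtinian B (B ⧸ LinearMap.ker f) := isArtinian_of_tower O h1
  have h3 : IsArtinian B (LinearMap.range f) := isArtinian_of_linearEquiv f.quotKerEquivRange
  have : Nontrivial (LinearMap.range f) :=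
    ⟨⟨⟨x, 1, one_smul B x⟩, 0, fun h ↦ hx (congrArg Subtype.val h)⟩⟩
  obtain ⟨W, hW, -⟩ := (eq_bot_or_exists_atom_le (⊤ : Submodule B (LinearMap.range f))).resolve_left
    top_ne_bot
  have := isSimpleModule_iff_isAtom.2 hW
  exact ⟨W.map (LinearMap.range f).subtype, IsSimpleModule.congr
    (Submodule.equivMapOfInjective _ (LinearMap.range f).injective_subtype W).symm⟩

end Simple

/-! ### The prime of elements acting non-injectively -/

section AssociatedPrime

variable {R : Type u} [CommRing R] {A : Type v} [Ring A] [Algebra R A]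
  {E : Type w} [AddCommGroup E] [Module R E] [Module A E] [IsScalarTower R A E]

/-- Multiplication by `r : R` on an `A`-module, as an `A`-linear map. -/
noncomputable def smulEnd (A : Type v) [Ring A] [Algebra R A] (E : Type w) [AddCommGroup E]
    [Module R E] [Module A E] [IsScalarTower R A E] (r : R) : E →ₗ[A] E :=
  r • LinearMap.id

@[simp]
theorem smulEnd_apply (r : R) (x : E) : smulEnd A E r x = r • x := rfl

/-- The elements of `R` that act non-injectively on a uniform module form a prime ideal. -/
noncomputable def nonInjectivePrime (R : Type u) [CommRing R] [Algebra R A] [Module R E]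
    [IsScalarTower R A E] (hinj : Module.Injective A E) (hind : IsIndecomposable A E) :
    PrimeSpectrum R where
  asIdeal :=
    { carrier := {r | LinearMap.ker (smulEnd A E r) ≠ ⊥}
      zero_mem' := by
        obtain ⟨x, hx⟩ := @exists_ne E hind.1 0
        exact fun h ↦ hx (LinearMap.ker_eq_bot'.1 h x (zero_smul R x))
      add_mem' := by
        intro r s hr hs hrs
        refine (hind.eq_bot_or_eq_bot hinj ?_).elim hr hs
        rw [Submodule.disjoint_def]
        intro x (hx : r • x = 0) (hx' : s • x = 0)
        exact LinearMap.ker_eq_bot'.1 hrs x (by rw [smulEnd_apply, add_smul, hx, hx', add_zero])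
      smul_mem' := by
        intro c r hr hcr
        refine hr (LinearMap.ker_eq_bot'.2 fun x (hx : r • x = 0) ↦
          LinearMap.ker_eq_bot'.1 hcr x ?_)
        rw [smulEnd_apply, smul_eq_mul, mul_smul, hx, smul_zero] }
  isPrime := by
    refine ⟨?_, ?_⟩
    · rw [Ideal.ne_top_iff_one]
      exact fun h ↦ h (LinearMap.ker_eq_bot'.2 fun x hx ↦ by rwa [smulEnd_apply, one_smul] at hx)
    · intro r s hrs
      by_contra! h
      obtain ⟨hr, hs⟩ := h
      have hr' := LinearMap.ker_eq_bot'.1 (not_not.1 hr)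
      have hs' := LinearMap.ker_eq_bot'.1 (not_not.1 hs)
      refine hrs (LinearMap.ker_eq_bot'.2 fun x hx ↦ hs' x (hr' _ ?_))
      rwa [smulEnd_apply, mul_smul] at hx

variable (hinj : Module.Injective A E) (hind : IsIndecomposable A E)

theorem mem_nonInjectivePrime {r : R} :
    r ∈ (nonInjectivePrime R hinj hind).asIdeal ↔ ∃ x : E, x ≠ 0 ∧ r • x = 0 := by
  change LinearMap.ker (smulEnd A E r) ≠ ⊥ ↔ _
  rw [Submodule.ne_bot_iff]
  exact exists_congr fun x ↦ and_comm

theorem bijective_smul_of_notMem {r : R} (hr : r ∉ (nonInjectivePrime R hinj hind).asIdeal) :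
    Function.Bijective (fun x : E ↦ r • x) :=
  hind.bijective_of_injective hinj (smulEnd A E r) (LinearMap.ker_eq_bot.1 (not_not.1 hr))

/-- The elements of an `A`-module killed by some element of `R` outside `p`. -/
def torsionAt (A : Type v) [Ring A] [Algebra R A] (E : Type w) [AddCommGroup E]
    [Module R E] [Module A E] [IsScalarTower R A E] (p : PrimeSpectrum R) : Submodule A E where
  carrier := {x | ∃ s ∉ p.asIdeal, s • x = 0}
  zero_mem' := ⟨1, p.asIdeal.one_notMem, smul_zero 1⟩
  add_mem' := by
    rintro x y ⟨s, hs, hx⟩ ⟨t, ht, hy⟩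
    refine ⟨s * t, fun h ↦ (p.isPrime.mem_or_mem h).elim hs ht, ?_⟩
    rw [smul_add, mul_smul s t y, hy, mul_comm, mul_smul, hx, smul_zero, smul_zero, add_zero]
  smul_mem' := by
    rintro a x ⟨s, hs, hx⟩
    exact ⟨s, hs, by rw [smul_comm, hx, smul_zero]⟩

/-- If some regular element acts non-injectively on a codivisorial indecomposable injective module,
then the elements acting non-injectively form a prime of height one. Only finitely many primes of
height one contain the regular element, so by uniformity one of them has no torsion in `E`. -/
theorem height_nonInjectivePrime (hR : IsPseudoNoetherianRing R) (hcod : IsCodivisorial R A E)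
    {a : R} (ha : a ∈ nonZeroDivisors R) (haq : a ∈ (nonInjectivePrime R hinj hind).asIdeal) :
    (nonInjectivePrime R hinj hind).asIdeal.height = 1 := by
  obtain ⟨x, hx, hax⟩ := (mem_nonInjectivePrime hinj hind).1 haq
  have hfin : {p : PrimeSpectrum R | p.asIdeal ∈ (Ideal.span {a}).minimalPrimes ∧
      p.asIdeal.height = 1}.Finite :=
    ((hR.finite_minimalPrimes a).preimage
      (f := PrimeSpectrum.asIdeal) fun p _ p' _ h ↦ PrimeSpectrum.ext h).subset fun p hp ↦ hp.1
  have hX : Submodule.span A {x} ≠ ⊥ := by rwa [Ne, Submodule.span_singleton_eq_bot]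
  have hinf : Submodule.span A {x} ⊓ hfin.toFinset.inf (torsionAt A E) = ⊥ := by
    refine hcod _ fun p hp ↦ LocalizedModule.subsingleton_iff.2 ?_
    rintro ⟨y, hyx, hy⟩
    by_cases hap : a ∈ p.asIdeal
    · have hpF : p ∈ hfin.toFinset := hfin.mem_toFinset.2
        ⟨mem_minimalPrimes_span_singleton_of_height_eq_one hp ha hap, hp⟩
      obtain ⟨s, hs, hsy⟩ := (Finset.inf_le hpF : _ ≤ torsionAt A E p) hy
      exact ⟨s, hs, Subtype.ext hsy⟩
    · refine ⟨a, hap, Subtype.ext ?_⟩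
      obtain ⟨c, rfl⟩ := Submodule.mem_span_singleton.1 hyx
      change a • c • x = 0
      rw [smul_comm, hax, smul_zero]
  obtain ⟨p, hp, hp0⟩ := hind.exists_eq_bot_of_finset hinj _ _ hinf hX
  obtain ⟨hpa, hp1⟩ := hfin.mem_toFinset.1 hp
  have hle : (nonInjectivePrime R hinj hind).asIdeal ≤ p.asIdeal := by
    intro r hr
    by_contra hrp
    obtain ⟨y, hy, hry⟩ := (mem_nonInjectivePrime hinj hind).1 hr
    have hyt : y ∈ torsionAt A E p := ⟨r, hrp, hry⟩
    rw [hp0] at hyt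
    exact hy hyt
  have hge := hpa.2 ⟨(nonInjectivePrime R hinj hind).isPrime,
    (Ideal.span_singleton_le_iff_mem _).2 haq⟩ hle
  rw [hle.antisymm hge, hp1]

end AssociatedPrime

/-! ### Classification of the indecomposable injective codivisorial modules -/

section Classification

variable {R : Type u} [CommRing R] {A : Type v} [Ring A] [Algebra R A]
  {E : Type w} [AddCommGroup E] [Module R E] [Module A E] [IsScalarTower R A E]

/-- If the complement of a minimal prime `n` acts bijectively, then `E` is a module over the
semisimple ring `A_n`; indecomposability makes it simple. -/
theorem isSimpleComponentAt [IsReduced R] (hR : IsPseudoNoetherianRing R)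
    (hA : IsReducedPseudoNoetherianOrder R A) (hind : IsIndecomposable A E) {n : PrimeSpectrum R}
    (hn : n.asIdeal ∈ minimalPrimes R)
    (hbij : ∀ s ∈ n.asIdeal.primeCompl, Function.Bijective (fun x : E ↦ s • x)) :
    IsSimpleComponentAt (A := A) n E := by
  have := hA.isSemisimpleRing_locAlg hR hn
  let _ : Module (LocAlg A n) E := localizedActionModule n.asIdeal.primeCompl hbij
  have hsmul : ∀ (a : A) (x : E), toLoc n a • x = a • x :=
    localizedActionModule_mk_one_smul n.asIdeal.primeCompl hbij
  let res : Submodule (LocAlg A n) E → Submodule A E := fun W ↦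
    { W.toAddSubmonoid with
      smul_mem' := fun a x hx ↦ by
        rw [← hsmul]
        exact W.smul_mem _ hx }
  have hres : ∀ W x, x ∈ res W ↔ x ∈ W := fun _ _ ↦ Iff.rfl
  have hres_bot : ∀ W, res W = ⊥ → W = ⊥ := fun W hW ↦ (Submodule.eq_bot_iff W).2 fun x hx ↦ by
    have := (hres W x).2 hx
    rwa [hW] at this
  have : Nontrivial E := hind.1
  have hsimple : IsSimpleModule (LocAlg A n) E := by
    rw [isSimpleModule_iff]
    refine ⟨fun W ↦ ?_⟩
    obtain ⟨W', hW'⟩ := exists_isCompl W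
    have hcompl : IsCompl (res W) (res W') := by
      refine ⟨?_, ?_⟩
      · rw [Submodule.disjoint_def]
        intro x hx hx'
        exact Submodule.disjoint_def.1 hW'.disjoint x hx hx'
      · rw [codisjoint_iff, eq_top_iff]
        intro x _
        obtain ⟨y, hy, z, hz, rfl⟩ := Submodule.mem_sup.1
          (hW'.codisjoint.eq_top ▸ Submodule.mem_top : x ∈ W ⊔ W')
        exact Submodule.add_mem_sup ((hres W y).2 hy) ((hres W' z).2 hz)
    rcases hind.2 _ _ hcompl with h | h
    · exact Or.inl (hres_bot W h)
    · have h' := hW'.codisjoint.eq_top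
      rw [hres_bot W' h, sup_bot_eq] at h'
      exact Or.inr h'
  obtain ⟨I, ⟨e⟩⟩ := IsSemisimpleRing.exists_linearEquiv_ideal_of_isSimpleModule (LocAlg A n) E
  refine ⟨I, IsSimpleModule.congr e.symm, e.toAddEquiv, fun a x ↦ ?_⟩
  rw [← hsmul]
  exact e.map_smul _ _

theorem toLoc_algebraMap_mul_comm (p : PrimeSpectrum R) (r : R) (b : LocAlg A p) :
    toLoc p (algebraMap R A r) * b = b * toLoc p (algebraMap R A r) := by
  induction b using LocalizedModule.induction_on with | _ a s
  rw [toLoc, LocalizedModule.mk_mul_mk, LocalizedModule.mk_mul_mk, Algebra.commutes, mul_comm]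

/-- The annihilator in `A` of a simple `A_p`-module is a prime ideal. -/
theorem isPrimeIdeal_annihilator (p : PrimeSpectrum R) {U : Type*} [AddCommGroup U] [Module A U]
    [Module (LocAlg A p) U] [hU : IsSimpleModule (LocAlg A p) U]
    (hres : ∀ (a : A) (x : U), toLoc p a • x = a • x) :
    IsPrimeIdeal (Module.annihilator A U) where
  isTwoSided := inferInstance
  ne_top h := by
    have := hU.nontrivial
    obtain ⟨x, hx⟩ := exists_ne (0 : U)
    have h1 : (1 : A) ∈ Module.annihilator A U := h ▸ Submodule.mem_top
    exact hx (by simpa using Module.mem_annihilator.1 h1 x)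
  le_or_le I J _ _ hIJ := by
    by_contra! h
    obtain ⟨hI, hJ⟩ := h
    obtain ⟨j, hj, hjU⟩ := SetLike.not_le_iff_exists.1 hJ
    obtain ⟨x, hx⟩ : ∃ x : U, j • x ≠ 0 := by
      by_contra! hall
      exact hjU (Module.mem_annihilator.2 hall)
    refine hI fun i hi ↦ Module.mem_annihilator.2 fun y ↦ ?_
    obtain ⟨b, rfl⟩ := IsSimpleModule.toSpanSingleton_surjective (LocAlg A p) hx y
    induction b using LocalizedModule.induction_on with | _ c s
    have h0 : (i * (c * j)) • x = 0 :=
      Module.mem_annihilator.1 (hIJ (Ideal.mul_mem_mul hi (J.mul_mem_left c hj))) x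
    rw [LinearMap.toSpanSingleton_apply, ← hres, ← hres, smul_smul, smul_smul,
      mul_assoc]
    have hb : toLoc p i * (LocalizedModule.mk c s * toLoc p j)
        = LocalizedModule.mk 1 s * toLoc p (i * (c * j)) := by
      rw [toLoc, toLoc, toLoc, LocalizedModule.mk_mul_mk, LocalizedModule.mk_mul_mk,
        LocalizedModule.mk_mul_mk, one_mul, one_mul]
    rw [hb, mul_smul, hres, h0, smul_zero]

/-- If the elements acting non-injectively form a prime `p` of height one containing a regular
element `a`, then `E` is an `A_p`-module. An element `x ≠ 0` killed by `a` generates a quotient of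
`A_p / a A_p`, which has finite length, so `E` contains a simple `A_p`-submodule `U`. The embedding
of `U` is essential because `E` is uniform. -/
theorem exists_isInjectiveEnvelope (hR : IsPseudoNoetherianRing R)
    (hA : IsReducedPseudoNoetherianOrder R A) (hinj : Module.Injective A E)
    (hind : IsIndecomposable A E) {p : PrimeSpectrum R} (hp : p = nonInjectivePrime R hinj hind)
    (hht : p.asIdeal.height = 1) {a : R} (ha : a ∈ nonZeroDivisors R) (hap : a ∈ p.asIdeal) :
    ∃ P : Ideal A, LiesOverPrime P p ∧
      ∃ (U : Type w) (_ : AddCommGroup U) (_ : Module A U) (_ : Module (LocAlg A p) U)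
        (i : U →ₗ[A] E), IsSimpleAttachedTo P p U ∧ IsInjectiveEnvelope i := by
  have hmem : ∀ r, r ∈ p.asIdeal ↔ ∃ x : E, x ≠ 0 ∧ r • x = 0 := fun r ↦ by
    rw [hp, mem_nonInjectivePrime]
  have hbij : ∀ s ∈ p.asIdeal.primeCompl, Function.Bijective (fun x : E ↦ s • x) := fun s hs ↦
    bijective_smul_of_notMem hinj hind (hp ▸ hs)
  let _ : Module (LocAlg A p) E := localizedActionModule p.asIdeal.primeCompl hbij
  have hsmul : ∀ (a : A) (x : E), toLoc p a • x = a • x :=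
    localizedActionModule_mk_one_smul p.asIdeal.primeCompl hbij
  obtain ⟨x, hx, hax⟩ := (hmem a).1 hap
  obtain ⟨W, hW⟩ := exists_isSimpleModule (hA.isFiniteLength_quotient hR hht ha hap) hx (by
    rintro _ ⟨b, rfl⟩
    have hab : algebraMap R (Localization.AtPrime p.asIdeal) a • b
        = b * toLoc p (algebraMap R A a) := by
      rw [algebraMap_smul, ← toLoc_algebraMap_mul_comm]
      induction b using LocalizedModule.induction_on with | _ c s
      rw [toLoc, LocalizedModule.mk_mul_mk, LocalizedModule.smul'_mk, one_mul, Algebra.smul_def]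
    rw [LinearMap.lsmul_apply, hab, mul_smul, hsmul, algebraMap_smul, hax, smul_zero])
  let _ : Module A W := Module.compHom W
    (LocalizedModule.numeratorRingHom : A →+* LocalizedModule p.asIdeal.primeCompl A)
  have hres : ∀ (a : A) (y : W), toLoc p a • y = a • y := fun _ _ ↦ rfl
  let i : W →ₗ[A] E :=
    { toFun := Subtype.val
      map_add' := fun _ _ ↦ rfl
      map_smul' := fun a y ↦ hsmul a y }
  have hi : Function.Injective i := Subtype.val_injective
  have : Nontrivial W := hW.nontrivial
  have hrange : LinearMap.range i ≠ ⊥ := fun h ↦ by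
    obtain ⟨y, hy⟩ := exists_ne (0 : W)
    rw [LinearMap.range_eq_bot] at h
    exact hy (hi (by rw [h]; rfl))
  refine ⟨Module.annihilator A W, ⟨isPrimeIdeal_annihilator p hres, ?_⟩, W, inferInstance,
    inferInstance, inferInstance, i, ⟨hres, hW, rfl⟩, hinj, hi, fun N hN ↦
    (hind.eq_bot_or_eq_bot hinj (disjoint_iff.2 hN)).resolve_right hrange⟩
  ext r
  rw [Ideal.mem_comap, Module.mem_annihilator]
  have hr : ∀ y : W, i (algebraMap R A r • y) = r • (i y) := fun y ↦ by
    rw [map_smul, algebraMap_smul]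
  constructor
  · intro h
    obtain ⟨y, hy⟩ := exists_ne (0 : W)
    exact (hmem r).2 ⟨i y, fun h0 ↦ hy (hi (h0.trans (map_zero i).symm)), by
      rw [← hr, h, map_zero]⟩
  · intro hrp
    -- the kernel of `r` on `E` is nonzero, so by uniformity it meets the simple module `W`
    have hker : LinearMap.ker (smulEnd A E r) ≠ ⊥ := by
      obtain ⟨z, hz, hrz⟩ := (hmem r).1 hrp
      exact fun h ↦ hz (LinearMap.ker_eq_bot'.1 h z hrz)
    obtain ⟨z, hz, hz0⟩ : ∃ z ∈ LinearMap.ker (smulEnd A E r) ⊓ LinearMap.range i, z ≠ 0 := by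
      rw [← Submodule.ne_bot_iff, Ne, ← disjoint_iff]
      exact fun h ↦ (hind.eq_bot_or_eq_bot hinj h).elim hker hrange
    obtain ⟨hrz, y, rfl⟩ := hz
    have hy : y ≠ 0 := fun h ↦ hz0 (by rw [h, map_zero])
    have hry : algebraMap R A r • y = 0 := hi (by rw [hr, map_zero]; exact hrz)
    intro y'
    obtain ⟨b, rfl⟩ := IsSimpleModule.toSpanSingleton_surjective (LocAlg A p) hy y'
    rw [LinearMap.toSpanSingleton_apply, ← hres, smul_smul, toLoc_algebraMap_mul_comm, mul_smul,
      hres, hry, smul_zero]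

end Classification

end PseudoKrull

theorem theorem2 {R : Type u} [CommRing R] [IsReduced R]
    (hR : PseudoKrull.IsPseudoNoetherianRing R)
    {A : Type v} [Ring A] [Algebra R A]
    (hA : PseudoKrull.IsReducedPseudoNoetherianOrder R A)
    {E : Type w} [Small.{w} A] [AddCommGroup E] [Module R E] [Module A E] [IsScalarTower R A E]
    (hinj : Module.Injective A E)
    (hind : PseudoKrull.IsIndecomposable A E)
    (hcod : PseudoKrull.IsCodivisorial R A E) :
    (∃ n : PrimeSpectrum R, n.asIdeal ∈ minimalPrimes R ∧
      PseudoKrull.IsSimpleComponentAt (A := A) n E) ∨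
    (∃ (p : PrimeSpectrum R) (P : Ideal A), p.asIdeal.height = 1 ∧
      PseudoKrull.LiesOverPrime P p ∧
      ∃ (U : Type w) (_ : AddCommGroup U) (_ : Module A U) (_ : Module (PseudoKrull.LocAlg A p) U)
        (i : U →ₗ[A] E),
        PseudoKrull.IsSimpleAttachedTo P p U ∧ PseudoKrull.IsInjectiveEnvelope i) := by
  by_cases h : ∃ a ∈ (PseudoKrull.nonInjectivePrime R hinj hind).asIdeal, a ∈ nonZeroDivisors R
  · obtain ⟨a, haq, ha⟩ := h
    have hht := PseudoKrull.height_nonInjectivePrime hinj hind hR hcod ha haq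
    obtain ⟨P, hP, hU⟩ := PseudoKrull.exists_isInjectiveEnvelope hR hA hinj hind rfl hht ha haq
    exact Or.inr ⟨_, P, hht, hP, hU⟩
  · push Not at h
    have hn := PseudoKrull.mem_minimalPrimes_of_disjoint_nonZeroDivisors
      hR.finite_minimalPrimes_ring h
    exact Or.inl ⟨_, hn, PseudoKrull.isSimpleComponentAt hR hA hind hn fun s hs ↦
      PseudoKrull.bijective_smul_of_notMem hinj hind hs⟩
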